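/- Let $k$ be a $\sigma$-field, i.e. a field with a ring endomorphism $\sigma\colon k\to k$. A $k$-$\sigma$-algebra is a commutative $k$-algebra $R$ with a ring endomorphism $\sigma\colon R\to R$ extending (via $k\to R$) that of $k$; morphisms are $k$-algebra maps commuting with $\sigma$, and $\sigma(a\otimes b)=\sigma(a)\otimes\sigma(b)$ on tensor products. A $\sigma$-variety over $k$ is a functor from $k$-$\sigma$-algebras to sets that is represented by a finitely $\sigma$-generated $k$-$\sigma$-algebra; it is non-empty if this algebra is nonzero. A $\sigma$-algebraic group over $k$ is a group object in the category of $\sigma$-varieties. Let $G$ be a $\sigma$-algebraic group over $k$. A $G$-torsor is a non-empty $\sigma$-variety $X$ with an action of $G$ such that $G(R)\times X(R)\to X(R)\times X(R)$, $(g,x)\mapsto(g.x,x)$, is bijective for every $k$-$\sigma$-algebra $R$; isomorphisms of $G$-torsors are $G$-equivariant isomorphisms of functors. For a $k$-$\sigma$-algebra $A$ let $\delta_1,\delta_2\colon A\to A\otimes_kA$ be $a\mapsto 1\otimes a$, $a\mapsto a\otimes 1$, and let $\partial_1,\partial_2,\partial_3\colon A\otimes_kA\to A\otimes_kA\otimes_kA$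 be $a\otimes b\mapsto 1\otimes a\otimes b,\ a\otimes 1\otimes b,\ a\otimes b\otimes 1$; the same symbols denote the induced maps on points of $G$ and of torsors. A cocycle is an element $\chi\in G(A\otimes_kA)$ with $\partial_2(\chi)=\partial_1(\chi)\partial_3(\chi)$, and $\chi_1,\chi_2$ are equivalent if $\chi_1=\delta_1(\alpha)\chi_2\delta_2(\alpha)^{-1}$ for some $\alpha\in G(A)$. Let $H^1_\sigma(A/k,G)$ be the set of equivalence classes of cocycles. A morphism $A\to B$ of $k$-$\sigma$-algebras induces a map $H^1_\sigma(A/k,G)\to H^1_\sigma(B/k,G)$. **Theorem.** 1. If $A$ and $B$ are nonzero, the map $H^1_\sigma(A/k,G)\to H^1_\sigma(B/k,G)$ induced by a morphism $A\to B$ is injective and does not depend on the choice of the morphism $A\to B$. 2. Let $H^1_\sigma(k,G)=\varinjlim H^1_\sigma(A/k,G)$ be the direct limit over all nonzero $k$-$\sigma$-algebras $A$ along these maps. There is a bijection between $H^1_\sigma(k,G)$ and the set of isomorphism classes of $G$-torsors with the following property: if $X$ is a $G$-torsor, $A$ a nonzero $k$-$\sigma$-algebra, $x\in X(A)$ and $\chi\in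 G(A\otimes_kA)$ is the element with $\delta_1(x)=\chi.\delta_2(x)$, then $\chi$ is a cocycle and the image of its class in $H^1_\sigma(k,G)$ corresponds to the isomorphism class of $X$. -/

import Mathlib

open CategoryTheory
open scoped TensorProduct

universe u

/-! Difference algebra over a difference ring, i.e. a commutative ring `k` together with a
ring endomorphism `σ : k →+* k` (not assumed injective or surjective). -/

section DiffAlg

variable {k : Type u} [CommRing k]

/-- A `k`-`σ`-algebra: a commutative `k`-algebra with an endomorphism that extends `σ`
along the structure map. -/
structure DiffAlg (σ : k →+* k) where
  carrier : Type u
  [commRing : CommRing carrier]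
  [algebra : Algebra k carrier]
  /-- the difference operator -/
  endo : carrier →+* carrier
  endo_algebraMap : ∀ c : k, endo (algebraMap k carrier c) = algebraMap k carrier (σ c)

attribute [instance] DiffAlg.commRing DiffAlg.algebra

namespace DiffAlg

variable {σ : k →+* k}

instance : CoeSort (DiffAlg σ) (Type u) := ⟨DiffAlg.carrier⟩

/-- Morphisms of `k`-`σ`-algebras: `k`-algebra maps commuting with the difference operators. -/
@[ext]
structure Hom (A B : DiffAlg σ) where
  toAlgHom : A →ₐ[k] B
  map_endo : ∀ a : A, toAlgHom (A.endo a) = B.endo (toAlgHom a)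

instance : Category (DiffAlg σ) where
  Hom A B := Hom A B
  id A := ⟨AlgHom.id k A, fun _ => rfl⟩
  comp f g := ⟨g.toAlgHom.comp f.toAlgHom, fun a => by
    simp [f.map_endo, g.map_endo]⟩

@[ext]
theorem hom_ext {A B : DiffAlg σ} {f g : A ⟶ B} (h : f.toAlgHom = g.toAlgHom) : f = g :=
  Hom.ext h

@[simp]
theorem id_toAlgHom (A : DiffAlg σ) : Hom.toAlgHom (𝟙 A) = AlgHom.id k A := rfl

@[simp]
theorem comp_toAlgHom {A B C : DiffAlg σ} (f : A ⟶ B) (g : B ⟶ C) :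
    (f ≫ g).toAlgHom = g.toAlgHom.comp f.toAlgHom := rfl

/-- The difference operator as a `σ`-semilinear map. -/
def endoₛₗ (A : DiffAlg σ) : A →ₛₗ[σ] A where
  toFun := A.endo
  map_add' := map_add A.endo
  map_smul' c a := by
    rw [Algebra.smul_def, map_mul, A.endo_algebraMap, ← Algebra.smul_def]

/-- The operator `a ⊗ b ↦ σ(a) ⊗ σ(b)` on `A ⊗[k] B`, as a ring endomorphism. -/
noncomputable def tensorEndo (A B : DiffAlg σ) : (A ⊗[k] B) →+* (A ⊗[k] B) where
  toFun := TensorProduct.map A.endoₛₗ B.endoₛₗ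
  map_zero' := map_zero _
  map_add' := map_add _
  map_one' := by
    simp [Algebra.TensorProduct.one_def, endoₛₗ]
  map_mul' x y := by
    induction x with
    | zero => simp
    | add x₁ x₂ h₁ h₂ => simp [add_mul, h₁, h₂]
    | tmul a b =>
      induction y with
      | zero => simp
      | add y₁ y₂ h₁ h₂ => simp [mul_add, h₁, h₂]
      | tmul c d => simp [endoₛₗ]

@[simp]
theorem tensorEndo_tmul (A B : DiffAlg σ) (a : A) (b : B) :
    tensorEndo A B (a ⊗ₜ[k] b) = A.endo a ⊗ₜ[k] B.endo b := rfl

/-- The tensor product `A ⊗ₖ B` with `σ(a ⊗ b) = σ(a) ⊗ σ(b)`. -/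
noncomputable def tensor (A B : DiffAlg σ) : DiffAlg σ where
  carrier := A ⊗[k] B
  endo := tensorEndo A B
  endo_algebraMap c := by
    rw [Algebra.TensorProduct.algebraMap_apply, tensorEndo_tmul, A.endo_algebraMap, map_one,
      Algebra.TensorProduct.algebraMap_apply]

/-- `a ↦ a ⊗ 1`. -/
noncomputable def inl (A B : DiffAlg σ) : A ⟶ tensor A B :=
  Hom.mk (Algebra.TensorProduct.includeLeft (R := k) (S := k) (A := A) (B := B))
    (fun a => by
      change A.endo a ⊗ₜ[k] (1 : B) = tensorEndo A B (a ⊗ₜ[k] (1 : B))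
      simp)

/-- `b ↦ 1 ⊗ b`. -/
noncomputable def inr (A B : DiffAlg σ) : B ⟶ tensor A B :=
  Hom.mk (Algebra.TensorProduct.includeRight (R := k) (A := A) (B := B))
    (fun b => by
      change (1 : A) ⊗ₜ[k] B.endo b = tensorEndo A B ((1 : A) ⊗ₜ[k] b)
      simp)

/-- The morphism `a ⊗ b ↦ f(a) g(b)` out of the tensor product. -/
noncomputable def desc {A B C : DiffAlg σ} (f : A ⟶ C) (g : B ⟶ C) : tensor A B ⟶ C :=
  Hom.mk (Algebra.TensorProduct.productMap f.toAlgHom g.toAlgHom)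
    (fun (x : A ⊗[k] B) => by
      change Algebra.TensorProduct.productMap f.toAlgHom g.toAlgHom (tensorEndo A B x) =
        C.endo (Algebra.TensorProduct.productMap f.toAlgHom g.toAlgHom x)
      induction x with
      | zero => simp
      | add x y hx hy => simp only [map_add, hx, hy]
      | tmul a b => simp [f.map_endo, g.map_endo])

/-- `R` is finitely `σ`-generated: `R = k{S}` for some finite subset `S`, that is, `R` is the only
`σ`-stable `k`-subalgebra that contains `S`. -/
def FinSigmaGenerated (R : DiffAlg σ) : Prop :=
  ∃ S : Finset R, ∀ T : Subalgebra k R, (∀ x ∈ T, R.endo x ∈ T) → (S : Set R) ⊆ T → T = ⊤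

end DiffAlg

/-- A `σ`-variety over `k`: a functor from `k`-`σ`-algebras to sets that is (co)represented by a
finitely `σ`-generated `k`-`σ`-algebra, its coordinate ring. -/
def IsDiffVariety {σ : k →+* k} (X : DiffAlg σ ⥤ Type u) : Prop :=
  ∃ B : DiffAlg σ, B.FinSigmaGenerated ∧ Nonempty (X.CorepresentableBy B)

/-- A `σ`-algebraic group over `k`: a group-valued functor whose functor of underlying sets is a
`σ`-variety (equivalently, a group object in the category of `σ`-varieties). -/
structure DiffAlgGroup (σ : k →+* k) where
  functor : DiffAlg σ ⥤ GrpCat.{u}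
  isDiffVariety : IsDiffVariety (functor ⋙ forget GrpCat.{u})

namespace DiffAlgGroup

variable {σ : k →+* k}

/-- The group `G(R)`. -/
abbrev pts (G : DiffAlgGroup σ) (R : DiffAlg σ) : Type u := G.functor.obj R

/-- The group homomorphism `G(R) → G(S)` induced by `R → S`. -/
abbrev map (G : DiffAlgGroup σ) {R S : DiffAlg σ} (f : R ⟶ S) : G.pts R →* G.pts S :=
  (G.functor.map f).hom

end DiffAlgGroup

end DiffAlg

/-! Torsors. -/

section Torsors

variable {k : Type u} [CommRing k] {σ : k →+* k}

/-- A `G`-torsor: a non-empty `σ`-variety `X` with an action of `G` (natural in `R`) such that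
`(g, x) ↦ (g • x, x)` is a bijection `G(R) × X(R) → X(R) × X(R)` for all `R`. Since every `X(0)` is
a point, `X` is non-empty when it has a point in some nonzero algebra (i.e. `k{X} ≠ 0`). -/
structure DiffTorsor (G : DiffAlgGroup σ) where
  functor : DiffAlg σ ⥤ Type u
  isDiffVariety : IsDiffVariety functor
  nonempty : ∃ R : DiffAlg σ, Nontrivial R ∧ Nonempty (functor.obj R)
  [action : ∀ R : DiffAlg σ, MulAction (G.pts R) (functor.obj R)]
  map_smul : ∀ {R S : DiffAlg σ} (f : R ⟶ S) (g : G.pts R) (x : functor.obj R),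
    functor.map f (g • x) = G.map f g • functor.map f x
  bijective : ∀ R : DiffAlg σ, Function.Bijective
    (fun p : G.pts R × functor.obj R => (p.1 • p.2, p.2))

attribute [instance] DiffTorsor.action

namespace DiffTorsor

variable {G : DiffAlgGroup σ}

/-- Morphisms of `G`-torsors: `G`-equivariant morphisms of functors. -/
@[ext]
structure Hom (X Y : DiffTorsor G) where
  toNatTrans : X.functor ⟶ Y.functor
  app_smul : ∀ (R : DiffAlg σ) (g : G.pts R) (x : X.functor.obj R),
    toNatTrans.app R (g • x) = g • toNatTrans.app R x

instance : Category (DiffTorsor G) where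
  Hom X Y := Hom X Y
  id X := ⟨𝟙 X.functor, fun _ _ _ => rfl⟩
  comp f g := ⟨f.toNatTrans ≫ g.toNatTrans, fun R a x => by
    simp [f.app_smul, g.app_smul]⟩

/-- The isomorphism classes of `G`-torsors. -/
def IsoClasses (G : DiffAlgGroup σ) : Type (u + 1) :=
  Quotient (isIsomorphicSetoid (DiffTorsor G))

/-- The isomorphism class of a torsor. -/
def isoClass (X : DiffTorsor G) : IsoClasses G :=
  Quotient.mk (isIsomorphicSetoid (DiffTorsor G)) X

end DiffTorsor

end Torsors

/-! Cohomology. -/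

section Cohomology

variable {k : Type u} [CommRing k] {σ : k →+* k}

namespace DiffAlg

/-- `A ⊗ₖ A`. -/
noncomputable abbrev tensor₂ (A : DiffAlg σ) : DiffAlg σ := tensor A A

/-- `A ⊗ₖ A ⊗ₖ A`. -/
noncomputable abbrev tensor₃ (A : DiffAlg σ) : DiffAlg σ := tensor (tensor A A) A

/-- `δ₁ : a ↦ 1 ⊗ a`. -/
noncomputable def δ₁ (A : DiffAlg σ) : A ⟶ A.tensor₂ := inr A A

/-- `δ₂ : a ↦ a ⊗ 1`. -/
noncomputable def δ₂ (A : DiffAlg σ) : A ⟶ A.tensor₂ := inl A A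

/-- `∂₁ : a ⊗ b ↦ 1 ⊗ a ⊗ b`. -/
noncomputable def d₁ (A : DiffAlg σ) : A.tensor₂ ⟶ A.tensor₃ :=
  desc (inr A A ≫ inl A.tensor₂ A) (inr A.tensor₂ A)

/-- `∂₂ : a ⊗ b ↦ a ⊗ 1 ⊗ b`. -/
noncomputable def d₂ (A : DiffAlg σ) : A.tensor₂ ⟶ A.tensor₃ :=
  desc (inl A A ≫ inl A.tensor₂ A) (inr A.tensor₂ A)

/-- `∂₃ : a ⊗ b ↦ a ⊗ b ⊗ 1`. -/
noncomputable def d₃ (A : DiffAlg σ) : A.tensor₂ ⟶ A.tensor₃ := inl A.tensor₂ A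

/-- `f ⊗ f : A ⊗ₖ A → B ⊗ₖ B`. -/
noncomputable def map₂ {A B : DiffAlg σ} (f : A ⟶ B) : A.tensor₂ ⟶ B.tensor₂ :=
  desc (f ≫ inl B B) (f ≫ inr B B)

/-- `f ⊗ f ⊗ f`. -/
noncomputable def map₃ {A B : DiffAlg σ} (f : A ⟶ B) : A.tensor₃ ⟶ B.tensor₃ :=
  desc (map₂ f ≫ inl B.tensor₂ B) (f ≫ inr B.tensor₂ B)

theorem inl_desc {A B C : DiffAlg σ} (f : A ⟶ C) (g : B ⟶ C) : inl A B ≫ desc f g = f := by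
  apply hom_ext
  change (Algebra.TensorProduct.productMap f.toAlgHom g.toAlgHom).comp
    Algebra.TensorProduct.includeLeft = f.toAlgHom
  simp

theorem inr_desc {A B C : DiffAlg σ} (f : A ⟶ C) (g : B ⟶ C) : inr A B ≫ desc f g = g := by
  apply hom_ext
  change (Algebra.TensorProduct.productMap f.toAlgHom g.toAlgHom).comp
    Algebra.TensorProduct.includeRight = g.toAlgHom
  simp

theorem tensor_hom_ext {A B C : DiffAlg σ} {p q : tensor A B ⟶ C}
    (hl : inl A B ≫ p = inl A B ≫ q) (hr : inr A B ≫ p = inr A B ≫ q) : p = q := by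
  apply hom_ext
  have hl' := congrArg Hom.toAlgHom hl
  have hr' := congrArg Hom.toAlgHom hr
  exact Algebra.TensorProduct.ext hl' (by exact hr')

theorem δ₁_map₂ {A B : DiffAlg σ} (f : A ⟶ B) : A.δ₁ ≫ map₂ f = f ≫ B.δ₁ := inr_desc _ _

theorem δ₂_map₂ {A B : DiffAlg σ} (f : A ⟶ B) : A.δ₂ ≫ map₂ f = f ≫ B.δ₂ := inl_desc _ _

theorem inl_map₂ {A B : DiffAlg σ} (f : A ⟶ B) : inl A A ≫ map₂ f = f ≫ inl B B := inl_desc _ _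

theorem inr_map₂ {A B : DiffAlg σ} (f : A ⟶ B) : inr A A ≫ map₂ f = f ≫ inr B B := inr_desc _ _

theorem inl_map₃ {A B : DiffAlg σ} (f : A ⟶ B) :
    inl A.tensor₂ A ≫ map₃ f = map₂ f ≫ inl B.tensor₂ B := inl_desc _ _

theorem inr_map₃ {A B : DiffAlg σ} (f : A ⟶ B) :
    inr A.tensor₂ A ≫ map₃ f = f ≫ inr B.tensor₂ B := inr_desc _ _

theorem d₁_map₃ {A B : DiffAlg σ} (f : A ⟶ B) : A.d₁ ≫ map₃ f = map₂ f ≫ B.d₁ := by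
  apply tensor_hom_ext
  · rw [d₁, d₁, ← Category.assoc, inl_desc, Category.assoc, inl_map₃, ← Category.assoc, inr_map₂,
      ← Category.assoc (inl A A), inl_map₂, Category.assoc, Category.assoc, inl_desc]
  · rw [d₁, d₁, ← Category.assoc, inr_desc, inr_map₃, ← Category.assoc (inr A A), inr_map₂,
      Category.assoc, inr_desc]

theorem d₂_map₃ {A B : DiffAlg σ} (f : A ⟶ B) : A.d₂ ≫ map₃ f = map₂ f ≫ B.d₂ := by
  apply tensor_hom_ext
  · rw [d₂, d₂, ← Category.assoc, inl_desc, Category.assoc, inl_map₃, ← Category.assoc, inl_map₂,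
      ← Category.assoc (inl A A), inl_map₂, Category.assoc, Category.assoc, inl_desc]
  · rw [d₂, d₂, ← Category.assoc, inr_desc, inr_map₃, ← Category.assoc (inr A A), inr_map₂,
      Category.assoc, inr_desc]

theorem d₃_map₃ {A B : DiffAlg σ} (f : A ⟶ B) : A.d₃ ≫ map₃ f = map₂ f ≫ B.d₃ := inl_map₃ f

end DiffAlg

namespace DiffAlgGroup

open DiffAlg

variable (G : DiffAlgGroup σ)

theorem map_comp_apply {R S T : DiffAlg σ} (f : R ⟶ S) (g : S ⟶ T) (x : G.pts R) :
    G.map (f ≫ g) x = G.map g (G.map f x) := by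
  simp [map]

/-- `∂₂(χ) = ∂₁(χ) ∂₃(χ)` in `G(A ⊗ A ⊗ A)`. -/
def IsCocycle (A : DiffAlg σ) (χ : G.pts A.tensor₂) : Prop :=
  G.map A.d₂ χ = G.map A.d₁ χ * G.map A.d₃ χ

/-- The 1-cocycles of `G` with respect to `A/k`. -/
def Z1 (A : DiffAlg σ) : Type u := {χ : G.pts A.tensor₂ // G.IsCocycle A χ}

/-- `χ₁ ∼ χ₂` iff `χ₁ = δ₁(α) χ₂ δ₂(α)⁻¹` for some `α ∈ G(A)`. -/
def cocycleSetoid (A : DiffAlg σ) : Setoid (G.Z1 A) where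
  r χ₁ χ₂ := ∃ α : G.pts A, χ₁.1 = G.map A.δ₁ α * χ₂.1 * (G.map A.δ₂ α)⁻¹
  iseqv :=
    { refl := fun χ => ⟨1, by simp⟩
      symm := by
        rintro χ₁ χ₂ ⟨α, h⟩
        refine ⟨α⁻¹, ?_⟩
        rw [h, map_inv, map_inv]
        group
      trans := by
        rintro χ₁ χ₂ χ₃ ⟨α, h⟩ ⟨β, h'⟩
        refine ⟨α * β, ?_⟩
        rw [h, h', map_mul, map_mul]
        group }

/-- The 1-cohomology set of `G` with respect to `A/k`. -/
def H1 (A : DiffAlg σ) : Type u := Quotient (G.cocycleSetoid A)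

/-- The class of a cocycle. -/
def H1.mk (A : DiffAlg σ) (χ : G.pts A.tensor₂) (h : G.IsCocycle A χ) : G.H1 A :=
  Quotient.mk (G.cocycleSetoid A) ⟨χ, h⟩

/-- The image of a cocycle under `G(A ⊗ A) → G(B ⊗ B)`. -/
noncomputable def mapZ1 {A B : DiffAlg σ} (f : A ⟶ B) (χ : G.Z1 A) : G.Z1 B :=
  ⟨G.map (map₂ f) χ.1, by
    have h : G.map A.d₂ χ.1 = G.map A.d₁ χ.1 * G.map A.d₃ χ.1 := χ.2
    have h' := congrArg (G.map (map₃ f)) h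
    rw [map_mul, ← map_comp_apply, ← map_comp_apply, ← map_comp_apply, d₁_map₃, d₂_map₃, d₃_map₃,
      map_comp_apply, map_comp_apply, map_comp_apply] at h'
    exact h'⟩

/-- The map of cohomology sets induced by a morphism `A → B`. -/
noncomputable def mapH1 {A B : DiffAlg σ} (f : A ⟶ B) : G.H1 A → G.H1 B :=
  Quotient.map' (s₁ := G.cocycleSetoid A) (s₂ := G.cocycleSetoid B) (G.mapZ1 f) (by
    rintro χ₁ χ₂ ⟨α, h⟩
    refine ⟨G.map f α, ?_⟩
    change G.map (map₂ f) χ₁.1 = _ * G.map (map₂ f) χ₂.1 * _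
    rw [h, map_mul, map_mul, map_inv, ← map_comp_apply, ← map_comp_apply, ← map_comp_apply,
      ← map_comp_apply, δ₁_map₂, δ₂_map₂])

/-- The direct limit of the sets `H¹(A/k, G)` over all nonzero `k`-`σ`-algebras `A`: the disjoint
union of these sets modulo the equivalence relation generated by identifying each class with its
images under all transition maps. -/
def H1lim : Type (u + 1) :=
  Quot (α := Σ A : {A : DiffAlg σ // Nontrivial A}, G.H1 A.1)
    (fun a b => ∃ f : a.1.1 ⟶ b.1.1, G.mapH1 f a.2 = b.2)

/-- The canonical map `H¹(A/k, G) → H¹(k, G)` for a nonzero `A`. -/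
def toH1lim (A : DiffAlg σ) (hA : Nontrivial A) (c : G.H1 A) : G.H1lim :=
  Quot.mk _ ⟨⟨A, hA⟩, c⟩

end DiffAlgGroup

end Cohomology

/-! A point `x` of a torsor over `A` has a cocycle `χ`; another `A`-point of the same torsor gives
an equivalent cocycle, and pushing `x` to `B` pushes `χ` to `B`. Conversely, every cocycle comes
from a torsor (`twistTorsor`), and torsors with `A`-points of equal cocycle are isomorphic
(`isoClass_eq_of_hasCocycle`). So `torsorClass` embeds `H¹(A/k, G)` into the isomorphism classes of
torsors, with image those having an `A`-point, and it is compatible with every transition map. Both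
claims of part 1 follow formally. For part 2, each torsor has a point in some nonzero algebra, and
classes over `A` and `B` can be compared over `A ⊗ B`.

The substance is descent along `k → A`. Since `k` is a field, a nonzero `A` has a linear form with
`s 1 = 1`, and contracting with it makes corepresentable functors satisfy `HasDescent`. To see that
the twist is a `σ`-variety one needs effective descent: over `A` it is the trivial torsor,
corepresented by `A ⊗ C` with `C` the coordinate ring of `G`, and the invariants of a coaction on `A
⊗ C` form the coordinate ring over `k`. -/

namespace DiffAlg

/-! ### Tensor products, contraction and the descent condition. -/

section CommRing

variable {k : Type u} [CommRing k] {σ : k →+* k}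

theorem desc_comp {A B C D : DiffAlg σ} (f : A ⟶ C) (g : B ⟶ C) (h : C ⟶ D) :
    desc f g ≫ h = desc (f ≫ h) (g ≫ h) :=
  tensor_hom_ext (by rw [← Category.assoc, inl_desc, inl_desc])
    (by rw [← Category.assoc, inr_desc, inr_desc])

theorem desc_inl_inr (A B : DiffAlg σ) : desc (inl A B) (inr A B) = 𝟙 (tensor A B) :=
  tensor_hom_ext (by rw [inl_desc, Category.comp_id]) (by rw [inr_desc, Category.comp_id])

theorem desc_inl_comp_inr_comp {A B C : DiffAlg σ} (h : tensor A B ⟶ C) :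
    desc (inl A B ≫ h) (inr A B ≫ h) = h := by
  rw [← desc_comp, desc_inl_inr, Category.id_comp]

/-- A morphism factors through an injective morphism if its range does. -/
theorem exists_lift {C R T : DiffAlg σ} (i : R ⟶ T) (hi : Function.Injective i.toAlgHom)
    (f : C ⟶ T) (h : ∀ c, f.toAlgHom c ∈ i.toAlgHom.range) : ∃ g : C ⟶ R, g ≫ i = f := by
  let g₀ : C →ₐ[k] R :=
    (AlgEquiv.ofInjective i.toAlgHom hi).symm.toAlgHom.comp (f.toAlgHom.codRestrict _ h)
  have hg : ∀ c, i.toAlgHom (g₀ c) = f.toAlgHom c := fun c =>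
    congrArg Subtype.val
      ((AlgEquiv.ofInjective i.toAlgHom hi).apply_symm_apply (f.toAlgHom.codRestrict _ h c))
  refine ⟨Hom.mk g₀ fun c => hi ?_, hom_ext (AlgHom.ext hg)⟩
  rw [hg, i.map_endo, hg, f.map_endo]

/-- Applying a linear form to the first factor of `A ⊗ R`. -/
noncomputable def contract {A : DiffAlg σ} (s : A →ₗ[k] k) (R : DiffAlg σ) :
    tensor A R →ₗ[k] R :=
  (TensorProduct.lid k R).toLinearMap ∘ₗ LinearMap.rTensor (R : Type u) s

theorem contract_tmul {A : DiffAlg σ} (s : A →ₗ[k] k) {R : DiffAlg σ} (a : A) (r : R) :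
    contract s R (a ⊗ₜ[k] r) = s a • r := by
  change TensorProduct.lid k R (LinearMap.rTensor (R : Type u) s (a ⊗ₜ[k] r)) = _
  simp

theorem contract_inr {A : DiffAlg σ} {s : A →ₗ[k] k} (hs : s 1 = 1) {R : DiffAlg σ} (r : R) :
    contract s R ((inr A R).toAlgHom r) = r := by
  change contract s R ((1 : A) ⊗ₜ[k] r) = r
  rw [contract_tmul, hs, one_smul]

theorem inr_injective {A : DiffAlg σ} {s : A →ₗ[k] k} (hs : s 1 = 1) (R : DiffAlg σ) :
    Function.Injective (inr A R).toAlgHom :=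
  Function.LeftInverse.injective (contract_inr hs)

/-- Together with `contract_inr` this computes the contraction of both embeddings `A ⊗ R ⇉ A ⊗ A ⊗
R`: one gives `1 ⊗ s(z)`, the other gives `z`. Hence an element `z` of the equalizer is `1 ⊗ s(z)`.
-/
theorem contract_desc {A : DiffAlg σ} (s : A →ₗ[k] k) {R : DiffAlg σ} (z : tensor A R) :
    contract s (tensor A R)
      ((desc (inl A (tensor A R)) (inr A R ≫ inr A (tensor A R))).toAlgHom z) =
      (inr A R).toAlgHom (contract s R z) := by
  change A ⊗[k] R at z
  induction z with
  | zero => erw [map_zero, map_zero]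
  | add x y hx hy => erw [map_add, map_add, map_add, map_add]; exact congrArg₂ _ hx hy
  | tmul a r =>
    have : (desc (inl A (tensor A R)) (inr A R ≫ inr A (tensor A R))).toAlgHom (a ⊗ₜ[k] r) =
        a ⊗ₜ[k] ((1 : A) ⊗ₜ[k] r : A ⊗[k] R) := by
      change (a ⊗ₜ[k] (1 : A ⊗[k] R)) * ((1 : A) ⊗ₜ[k] ((1 : A) ⊗ₜ[k] r : A ⊗[k] R)) = _
      simp
    rw [this, contract_tmul]
    erw [contract_tmul, map_smul]
    rfl

/-- A functor satisfies descent along `k → A` if, for all `R`, its value at `R` is the equalizer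
of its values at `A ⊗ R ⇉ A ⊗ A ⊗ R`. The equalizer condition is expressed by testing against all
pairs of morphisms from `A`. -/
def HasDescent (A : DiffAlg σ) (F : DiffAlg σ ⥤ Type u) : Prop :=
  ∀ (R : DiffAlg σ) (p : F.obj (tensor A R)),
    (∀ (S : DiffAlg σ) (a b : A ⟶ S) (r : R ⟶ S), F.map (desc a r) p = F.map (desc b r) p) →
      ∃! q : F.obj R, F.map (inr A R) q = p

theorem HasDescent.injective {A : DiffAlg σ} {F : DiffAlg σ ⥤ Type u} (h : HasDescent A F)
    (R : DiffAlg σ) : Function.Injective (F.map (inr A R)) := fun q q' hq =>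
  (h R (F.map (inr A R) q) fun S a b r => by
    rw [← Functor.map_comp_apply, ← Functor.map_comp_apply, inr_desc, inr_desc]).unique rfl hq.symm

end CommRing

/-! ### Descent over a field: points, algebras and finite generation. -/

section Field

variable {k : Type u} [Field k] {σ : k →+* k}

theorem exists_linearForm (A : DiffAlg σ) [Nontrivial A] : ∃ s : A →ₗ[k] k, s 1 = 1 := by
  obtain ⟨s, hs⟩ := (Algebra.linearMap k A).exists_leftInverse_of_injective
    (LinearMap.ker_eq_bot.2 (algebraMap k A).injective)
  exact ⟨s, by simpa using LinearMap.congr_fun hs 1⟩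

theorem hasDescent_of_corepresentableBy (A : DiffAlg σ) [Nontrivial A] {F : DiffAlg σ ⥤ Type u}
    {C : DiffAlg σ} (e : F.CorepresentableBy C) : HasDescent A F := by
  obtain ⟨s, hs⟩ := exists_linearForm A
  intro R p hp
  obtain ⟨φ, rfl⟩ := e.homEquiv.surjective p
  -- The universal test: the two inclusions of `A` into `A ⊗ A ⊗ R`.
  have hφ := hp (tensor A (tensor A R)) (inl A (tensor A R)) (inl A R ≫ inr A (tensor A R))
    (inr A R ≫ inr A (tensor A R))
  rw [desc_inl_comp_inr_comp, ← e.homEquiv_comp, ← e.homEquiv_comp] at hφ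
  replace hφ := e.homEquiv.injective hφ
  obtain ⟨q, hq⟩ := exists_lift (inr A R) (inr_injective hs R) φ fun c => by
    refine ⟨contract s R (φ.toAlgHom c), ?_⟩
    refine (contract_desc s _).symm.trans (Eq.trans ?_ (contract_inr hs (φ.toAlgHom c)))
    exact congrArg (fun ψ => contract s (tensor A R) (Hom.toAlgHom ψ c)) hφ
  refine ⟨e.homEquiv q, by beta_reduce; rw [← e.homEquiv_comp, hq], fun q' hq' => ?_⟩
  obtain ⟨ψ, rfl⟩ := e.homEquiv.surjective q'
  rw [← e.homEquiv_comp] at hq'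
  replace hq' := (e.homEquiv.injective hq').trans hq.symm
  refine congrArg _ (hom_ext (AlgHom.ext fun c => inr_injective hs R ?_))
  exact congrArg (fun ψ => Hom.toAlgHom ψ c) hq'

/-- The equalizer of two morphisms, as a difference subalgebra. -/
noncomputable def equalizer {M N : DiffAlg σ} (f g : M ⟶ N) : DiffAlg σ where
  carrier := AlgHom.equalizer f.toAlgHom g.toAlgHom
  endo := (M.endo.comp (AlgHom.equalizer f.toAlgHom g.toAlgHom).val.toRingHom).codRestrict
    (AlgHom.equalizer f.toAlgHom g.toAlgHom) fun x => by
      have hx : f.toAlgHom x.1 = g.toAlgHom x.1 := x.2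
      change f.toAlgHom (M.endo x.1) = g.toAlgHom (M.endo x.1)
      rw [f.map_endo, g.map_endo, hx]
  endo_algebraMap c := Subtype.ext (M.endo_algebraMap c)

/-- The inclusion of the equalizer. -/
noncomputable def equalizerι {M N : DiffAlg σ} (f g : M ⟶ N) : equalizer f g ⟶ M :=
  Hom.mk (AlgHom.equalizer f.toAlgHom g.toAlgHom).val fun _ => rfl

theorem equalizer_condition {M N : DiffAlg σ} (f g : M ⟶ N) :
    equalizerι f g ≫ f = equalizerι f g ≫ g :=
  hom_ext (AlgHom.ext fun x => x.2)

theorem desc_inl_comp_inr_toAlgHom {A M N : DiffAlg σ} (f : M ⟶ N) (z : tensor A M) :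
    (desc (inl A N) (f ≫ inr A N)).toAlgHom z =
      LinearMap.lTensor (A : Type u) f.toAlgHom.toLinearMap z := by
  change A ⊗[k] M at z
  induction z with
  | zero => exact (map_zero _).trans (map_zero _).symm
  | add x y hx hy => erw [map_add, map_add]; exact congrArg₂ _ hx hy
  | tmul a r =>
    change (a ⊗ₜ[k] (1 : N)) * ((1 : A) ⊗ₜ[k] f.toAlgHom r) = _
    simp

/-- Descent for an algebra over `A` along `k → A`: a coaction `ρ : M → A ⊗ M` of the trivial
groupoid of `A` comes from an isomorphism `A ⊗ B ≅ M`, where `B` is the algebra of invariants. -/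
theorem exists_tensor_iso_of_coaction {A M : DiffAlg σ} (i : A ⟶ M) (ρ : M ⟶ tensor A M)
    (hi : i ≫ ρ = inl A M) (counit : ρ ≫ desc i (𝟙 M) = 𝟙 M)
    (coassoc : ρ ≫ desc (inl A _) (ρ ≫ inr A (tensor A M)) =
      ρ ≫ desc (inl A _) (inr A M ≫ inr A (tensor A M))) :
    ∃ (B : DiffAlg σ) (j : B ⟶ M) (θ : M ⟶ tensor A B), j ≫ ρ = j ≫ inr A M ∧
      θ ≫ desc i j = 𝟙 M ∧ desc i j ≫ θ = 𝟙 _ ∧ θ ≫ desc (inl A M) (j ≫ inr A M) = ρ := by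
  let D : M →ₗ[k] tensor A M := ρ.toAlgHom.toLinearMap - (inr A M).toAlgHom.toLinearMap
  obtain ⟨B, j, hj, hjinj, hD⟩ : ∃ (B : DiffAlg σ) (j : B ⟶ M), j ≫ ρ = j ≫ inr A M ∧
      Function.Injective j.toAlgHom ∧ Function.Exact j.toAlgHom.toLinearMap D := by
    refine ⟨_, equalizerι ρ (inr A M), equalizer_condition _ _, fun _ _ h => Subtype.ext h,
      fun m => ?_⟩
    change ρ.toAlgHom m - (inr A M).toAlgHom m = 0 ↔ _
    rw [sub_eq_zero]
    exact ⟨fun h => ⟨⟨m, h⟩, rfl⟩, by rintro ⟨b, rfl⟩; exact b.2⟩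
  have hinj : Function.Injective (desc (inl A M) (j ≫ inr A M)).toAlgHom := by
    have := Module.Flat.lTensor_preserves_injective_linearMap (M := (A : Type u))
      j.toAlgHom.toLinearMap hjinj
    intro x y h
    rw [desc_inl_comp_inr_toAlgHom, desc_inl_comp_inr_toAlgHom] at h
    exact this h
  -- Coassociativity says that `ρ m` is killed by `id ⊗ D`. As `A` is flat and `B = ker D`, that
  -- kernel is `A ⊗ B`; so `θ` is `ρ` with smaller codomain.
  obtain ⟨θ, hθ⟩ := exists_lift _ hinj ρ fun m => by
    have h := congrArg (fun f => Hom.toAlgHom f m) coassoc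
    replace h : (desc (inl A _) (ρ ≫ inr A (tensor A M))).toAlgHom (ρ.toAlgHom m) =
      (desc (inl A _) (inr A M ≫ inr A (tensor A M))).toAlgHom (ρ.toAlgHom m) := h
    rw [desc_inl_comp_inr_toAlgHom, desc_inl_comp_inr_toAlgHom] at h
    obtain ⟨z, hz⟩ := (Module.Flat.lTensor_exact (A : Type u) hD _).1
      ((LinearMap.congr_fun (LinearMap.lTensor_sub _ _) _).trans (sub_eq_zero.2 h))
    exact ⟨z, (desc_inl_comp_inr_toAlgHom j z).trans hz⟩
  have hij : desc i j ≫ ρ = desc (inl A M) (j ≫ inr A M) := by rw [desc_comp, hi, hj]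
  refine ⟨B, j, θ, hj, ?_, ?_, hθ⟩
  · rw [← counit]
    nth_rewrite 1 [← hθ]
    rw [Category.assoc, desc_comp, inl_desc, Category.assoc, inr_desc,
      Category.comp_id]
  · have h : (desc i j ≫ θ) ≫ desc (inl A M) (j ≫ inr A M) = desc (inl A M) (j ≫ inr A M) := by
      rw [Category.assoc, hθ, hij]
    exact hom_ext (AlgHom.ext fun x => hinj (congrArg (fun f => Hom.toAlgHom f x) h))

/-- If `F` satisfies descent along `k → A` and the restriction of `F` to `A`-algebras is
corepresented by `M`, then `F` is corepresented by some `B` with `A ⊗ B ≅ M`. -/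
theorem exists_corepresentableBy_of_descent {A : DiffAlg σ} [Nontrivial A]
    {F : DiffAlg σ ⥤ Type u} (hF : HasDescent A F) {M : DiffAlg σ} (i : A ⟶ M) (u : F.obj M)
    (hM : ∀ (R : DiffAlg σ) (ι : A ⟶ R) (p : F.obj R),
      ∃! φ : M ⟶ R, i ≫ φ = ι ∧ F.map φ u = p) :
    ∃ (B : DiffAlg σ) (j : B ⟶ M) (θ : M ⟶ tensor A B),
      θ ≫ desc i j = 𝟙 M ∧ desc i j ≫ θ = 𝟙 _ ∧ Nonempty (F.CorepresentableBy B) := by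
  have ext : ∀ {R : DiffAlg σ} {φ ψ : M ⟶ R}, i ≫ φ = i ≫ ψ → F.map φ u = F.map ψ u → φ = ψ :=
    fun {R φ ψ} h h' => (hM R (i ≫ ψ) (F.map ψ u)).unique ⟨h, h'⟩ ⟨rfl, rfl⟩
  -- The coaction changes the `A`-structure under the universal point `u`. Its axioms hold because
  -- maps out of `M` are determined by their effect on `i` and `u`.
  obtain ⟨ρ, ⟨hiρ, huρ⟩, -⟩ := hM (tensor A M) (inl A M) (F.map (inr A M) u)
  obtain ⟨B, j, θ, hj, hθ, hθ', hρ⟩ := exists_tensor_iso_of_coaction i ρ hiρ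
    (ext (by rw [← Category.assoc, hiρ, inl_desc, Category.comp_id])
      (by rw [Functor.map_comp_apply, huρ, ← Functor.map_comp_apply, inr_desc]))
    (ext (by rw [← Category.assoc, ← Category.assoc, hiρ, inl_desc, inl_desc])
      (by
        rw [Functor.map_comp_apply, huρ, ← Functor.map_comp_apply, inr_desc,
          Functor.map_comp_apply, huρ, Functor.map_comp_apply, huρ, ← Functor.map_comp_apply,
          ← Functor.map_comp_apply, inr_desc]))
  have hjθ : j ≫ θ = inr A B := by
    rw [← inr_desc i j, Category.assoc, hθ', Category.comp_id]
  have hiθ : i ≫ θ = inl A B := by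
    rw [← inl_desc i j, Category.assoc, hθ', Category.comp_id]
  refine ⟨B, j, θ, hθ, hθ', ?_⟩
  -- The universal point of `B`: viewed in `F (A ⊗ B)`, `u` does not depend on the map from `A`, by
  -- `huρ`.
  obtain ⟨b, hb, -⟩ := hF B (F.map θ u) fun S a a' r => by
    have h := congrArg (F.map (desc a (θ ≫ desc a' r))) huρ
    rw [← Functor.map_comp_apply, ← Functor.map_comp_apply, inr_desc, ← hρ, Category.assoc,
      desc_comp, inl_desc, Category.assoc, inr_desc, ← Category.assoc, hjθ, inr_desc] at h
    rw [← Functor.map_comp_apply, ← Functor.map_comp_apply, h]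
  have hjb : F.map j b = u := by
    rw [← inr_desc i j, Functor.map_comp_apply, hb, ← Functor.map_comp_apply, hθ,
      Functor.map_id_apply]
  have hB := hasDescent_of_corepresentableBy A
    (Functor.CorepresentableBy.coyoneda (Opposite.op B))
  refine ⟨⟨fun {R} => Equiv.ofBijective (fun ψ => F.map ψ b) ⟨fun ψ ψ' h => ?_, fun p => ?_⟩,
    fun g f => Functor.map_comp_apply F f g b⟩⟩
  · have key : θ ≫ desc (inl A R) (ψ ≫ inr A R) = θ ≫ desc (inl A R) (ψ' ≫ inr A R) := by
      refine ext ?_ ?_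
      · rw [← Category.assoc, ← Category.assoc, hiθ, inl_desc, inl_desc]
      · rw [Functor.map_comp_apply, Functor.map_comp_apply, ← hb, ← Functor.map_comp_apply,
          ← Functor.map_comp_apply, inr_desc, inr_desc, Functor.map_comp_apply,
          Functor.map_comp_apply]
        exact congrArg _ h
    replace key := congrArg (j ≫ ·) key
    beta_reduce at key
    rw [← Category.assoc, ← Category.assoc, hjθ, inr_desc, inr_desc] at key
    exact hB.injective R key
  · obtain ⟨φ, ⟨hiφ, huφ⟩, -⟩ := hM (tensor A R) (inl A R) (F.map (inr A R) p)
    -- The map `φ` classifying `p` over `A ⊗ R` depends on the `A`-structure only through `ρ`, which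
    -- is trivial on `B`; so `j ≫ φ` descends to `R`.
    obtain ⟨q, hq, -⟩ := hB R (j ≫ φ) fun S a a' r => by
      have h : φ ≫ desc a r = ρ ≫ desc a (φ ≫ desc a' r) := by
        refine ext ?_ ?_
        · rw [← Category.assoc, ← Category.assoc, hiφ, hiρ, inl_desc, inl_desc]
        · rw [Functor.map_comp_apply, huφ, Functor.map_comp_apply, huρ, ← Functor.map_comp_apply,
            ← Functor.map_comp_apply, inr_desc, inr_desc, Functor.map_comp_apply, huφ,
            ← Functor.map_comp_apply, inr_desc]
      change (j ≫ φ) ≫ desc a r = (j ≫ φ) ≫ desc a' r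
      rw [Category.assoc, Category.assoc, h, ← Category.assoc, hj, Category.assoc, inr_desc]
    replace hq : q ≫ inr A R = j ≫ φ := hq
    refine ⟨q, hF.injective R ?_⟩
    beta_reduce
    rw [← Functor.map_comp_apply, hq, Functor.map_comp_apply, hjb, huφ]

/-- Being finitely `σ`-generated descends along `k → A`. -/
theorem finSigmaGenerated_of_tensor {A B C : DiffAlg σ} [Nontrivial A] (hC : C.FinSigmaGenerated)
    (e : tensor A C ⟶ tensor A B) (he : inl A C ≫ e = inl A B)
    (hsurj : Function.Surjective e.toAlgHom) : B.FinSigmaGenerated := by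
  classical
  obtain ⟨s, hs⟩ := exists_linearForm A
  obtain ⟨S, hS⟩ := hC
  choose Z hZ using fun c : C =>
    TensorProduct.exists_finset (R := k) (M := (A : Type u)) (N := (B : Type u))
      ((inr A C ≫ e).toAlgHom c)
  -- Generators of `B`: the second components of the tensors that express the images of the
  -- generators of `C`. If `T` contains them and is `σ`-stable, then `A ⊗ T` is all of `A ⊗ B`, and
  -- contraction gives `T = B`.
  refine ⟨S.biUnion fun c => (Z c).image Prod.snd, fun T hT hST => ?_⟩
  let ι := Algebra.TensorProduct.map (AlgHom.id k A) T.val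
  let U : Subalgebra k (A ⊗[k] B) := ι.range
  have hU : ∀ z ∈ U, tensorEndo A B z ∈ U := by
    rintro _ ⟨w, rfl⟩
    change tensorEndo A B (ι w) ∈ U
    induction w with
    | zero => simp
    | add x y hx hy => rw [map_add, map_add]; exact add_mem hx hy
    | tmul a t => exact ⟨A.endo a ⊗ₜ[k] ⟨B.endo t.1, hT _ t.2⟩, by simp [ι]⟩
  have hSU : ∀ c ∈ S, (inr A C ≫ e).toAlgHom c ∈ U := by
    intro c hc
    rw [hZ c]
    refine sum_mem fun p hp => ⟨p.1 ⊗ₜ[k] ⟨p.2, hST ?_⟩, by simp [ι]⟩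
    exact Finset.mem_coe.2
      (Finset.mem_biUnion.2 ⟨c, hc, Finset.mem_image.2 ⟨p, hp, rfl⟩⟩)
  have hCU := hS (U.comap (inr A C ≫ e).toAlgHom)
    (fun c hc => by
      change (inr A C ≫ e).toAlgHom (C.endo c) ∈ U
      rw [(inr A C ≫ e).map_endo]
      exact hU _ hc) hSU
  have heU : ∀ z : A ⊗[k] C, e.toAlgHom z ∈ U := by
    intro z
    induction z with
    | zero => erw [map_zero]; exact zero_mem U
    | add x y hx hy => erw [map_add]; exact add_mem hx hy
    | tmul a c =>
      have h₁ : e.toAlgHom ((inl A C).toAlgHom a) ∈ U :=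
        ⟨a ⊗ₜ[k] 1, by
          refine Eq.trans ?_ (congrArg (fun f => Hom.toAlgHom f a) he).symm
          change ι (a ⊗ₜ[k] 1) = a ⊗ₜ[k] (1 : B)
          simp [ι]⟩
      have h₂ : e.toAlgHom ((inr A C).toAlgHom c) ∈ U := by
        have : c ∈ U.comap (inr A C ≫ e).toAlgHom := hCU ▸ Algebra.mem_top
        exact this
      have h₃ : a ⊗ₜ[k] c = (inl A C).toAlgHom a * (inr A C).toAlgHom c := by
        change a ⊗ₜ[k] c = (a ⊗ₜ[k] (1 : C)) * ((1 : A) ⊗ₜ[k] c)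
        simp
      rw [h₃, map_mul]
      exact mul_mem h₁ h₂
  have hcontract : ∀ z ∈ U, contract s B z ∈ T := by
    rintro _ ⟨w, rfl⟩
    change contract s B (ι w) ∈ T
    induction w with
    | zero => rw [map_zero]; erw [map_zero]; exact zero_mem T
    | add x y hx hy => rw [map_add]; erw [map_add]; exact add_mem hx hy
    | tmul a t =>
      rw [Algebra.TensorProduct.map_tmul]
      erw [contract_tmul]
      exact T.smul_mem t.2 _
  refine eq_top_iff.2 fun b _ => ?_
  obtain ⟨z, hz⟩ := hsurj ((inr A B).toAlgHom b)
  rw [← contract_inr hs b, ← hz]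
  exact hcontract _ (heU z)

end Field

end DiffAlg

/-! ### Twisting the trivial torsor by a cocycle. -/

namespace DiffAlgGroup

open DiffAlg

section CommRing

variable {k : Type u} [CommRing k] {σ : k →+* k} {G : DiffAlgGroup σ}

/-- The cocycle condition, tested against all triples of morphisms from `A`. -/
theorem isCocycle_iff {A : DiffAlg σ} {χ : G.pts A.tensor₂} :
    G.IsCocycle A χ ↔ ∀ (S : DiffAlg σ) (a b c : A ⟶ S),
      G.map (desc a c) χ = G.map (desc b c) χ * G.map (desc a b) χ := by
  constructor
  · intro h S a b c
    have h' := congrArg (G.map (desc (desc a b) c)) h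
    rw [map_mul, ← map_comp_apply, ← map_comp_apply, ← map_comp_apply, d₁, d₂, d₃, desc_comp,
      desc_comp, inl_desc, inr_desc, Category.assoc, Category.assoc, inl_desc, inl_desc,
      inr_desc] at h'
    exact h'
  · intro h
    have h' := h A.tensor₃ (inl A A ≫ inl A.tensor₂ A) (inr A A ≫ inl A.tensor₂ A)
      (inr A.tensor₂ A)
    rw [desc_inl_comp_inr_comp] at h'
    exact h'

variable {A : DiffAlg σ} {χ : G.pts A.tensor₂}

variable (G A χ) in
/-- The functor of sections of the `G`-torsor obtained by twisting the trivial torsor by `χ`. -/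
noncomputable def twist : DiffAlg σ ⥤ Type u where
  -- Here `g` stands for the point `g • x`, where `x` is an `A`-point with cocycle `χ`. The
  -- condition says that `g • x` is the same for `a` and `b`, given that `b` and `a` carry `x` to
  -- points differing by `χ`.
  obj R := {g : G.pts (tensor A R) // ∀ (S : DiffAlg σ) (a b : A ⟶ S) (r : R ⟶ S),
    G.map (desc a r) g = G.map (desc b r) g * G.map (desc a b) χ}
  map {R R'} f := TypeCat.ofHom fun g => ⟨G.map (desc (inl A R') (f ≫ inr A R')) g.1,
    fun S a b r => by
      rw [← map_comp_apply, ← map_comp_apply, desc_comp, desc_comp, inl_desc, inl_desc,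
        Category.assoc, Category.assoc, inr_desc, inr_desc]
      exact g.2 S a b (f ≫ r)⟩
  map_id R := by
    refine ConcreteCategory.hom_ext _ _ fun g => Subtype.ext ?_
    change G.map (desc (inl A R) (𝟙 R ≫ inr A R)) g.1 = g.1
    rw [Category.id_comp, desc_inl_inr]
    simp [map]
  map_comp {R R' R''} f f' := by
    refine ConcreteCategory.hom_ext _ _ fun g => Subtype.ext ?_
    change G.map (desc (inl A R'') ((f ≫ f') ≫ inr A R'')) g.1 =
      G.map (desc (inl A R'') (f' ≫ inr A R'')) (G.map (desc (inl A R') (f ≫ inr A R')) g.1)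
    rw [← map_comp_apply, desc_comp, inl_desc, Category.assoc, Category.assoc, inr_desc]

theorem twist_map_coe {R S : DiffAlg σ} (f : R ⟶ S) (g : (twist G A χ).obj R) :
    ((twist G A χ).map f g).1 = G.map (desc (inl A S) (f ≫ inr A S)) g.1 := rfl

noncomputable instance (R : DiffAlg σ) : MulAction (G.pts R) ((twist G A χ).obj R) where
  smul h g := ⟨G.map (inr A R) h * g.1, fun S a b r => by
    rw [map_mul, map_mul, ← map_comp_apply, ← map_comp_apply, inr_desc, inr_desc, g.2 S a b r,
      mul_assoc]⟩
  one_smul g := Subtype.ext (by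
    change G.map (inr A R) 1 * g.1 = g.1
    rw [map_one, one_mul])
  mul_smul h h' g := Subtype.ext (by
    change G.map (inr A R) (h * h') * g.1 = G.map (inr A R) h * (G.map (inr A R) h' * g.1)
    rw [map_mul, mul_assoc])

theorem twist_smul_coe {R : DiffAlg σ} (h : G.pts R) (g : (twist G A χ).obj R) :
    (h • g).1 = G.map (inr A R) h * g.1 := rfl

theorem twist_map_smul {R S : DiffAlg σ} (f : R ⟶ S) (h : G.pts R) (g : (twist G A χ).obj R) :
    (twist G A χ).map f (h • g) = G.map f h • (twist G A χ).map f g := by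
  apply Subtype.ext
  rw [twist_map_coe, twist_smul_coe, twist_smul_coe, twist_map_coe, map_mul, ← map_comp_apply,
    ← map_comp_apply, inr_desc]

/-- The tautological point of the twist, with values in `A`. -/
def twistPoint (hχ : G.IsCocycle A χ) : (twist G A χ).obj A := ⟨χ, isCocycle_iff.1 hχ⟩

theorem twistPoint_coe (hχ : G.IsCocycle A χ) : (twistPoint hχ).1 = χ := rfl

theorem twist_map_δ₁_twistPoint (hχ : G.IsCocycle A χ) :
    (twist G A χ).map A.δ₁ (twistPoint hχ) = χ • (twist G A χ).map A.δ₂ (twistPoint hχ) := by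
  apply Subtype.ext
  rw [twist_smul_coe, twist_map_coe, twist_map_coe, twistPoint_coe]
  have h := isCocycle_iff.1 hχ _ (inl A A.tensor₂) (A.δ₂ ≫ inr A A.tensor₂)
    (A.δ₁ ≫ inr A A.tensor₂)
  rw [δ₁, δ₂, desc_inl_comp_inr_comp] at h
  exact h

end CommRing

section Field

variable {k : Type u} [Field k] {σ : k →+* k} {G : DiffAlgGroup σ} {A : DiffAlg σ} [Nontrivial A]

theorem existsUnique_map_inr (A : DiffAlg σ) [Nontrivial A] {R : DiffAlg σ}
    (p : G.pts (tensor A R)) (hp : ∀ (S : DiffAlg σ) (a b : A ⟶ S) (r : R ⟶ S),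
      G.map (desc a r) p = G.map (desc b r) p) : ∃! q : G.pts R, G.map (inr A R) q = p := by
  obtain ⟨C, -, ⟨e⟩⟩ := G.isDiffVariety
  exact hasDescent_of_corepresentableBy A e R p hp

theorem map_inr_injective (A : DiffAlg σ) [Nontrivial A] (R : DiffAlg σ) :
    Function.Injective (G.map (inr A R)) := by
  obtain ⟨C, -, ⟨e⟩⟩ := G.isDiffVariety
  exact (hasDescent_of_corepresentableBy A e).injective R

variable {χ : G.pts A.tensor₂}

/-- The factor from `χ` stands on the right, so it cancels in `y * x⁻¹`, which therefore descends to
`G(R)`. -/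
theorem twist_bijective (R : DiffAlg σ) : Function.Bijective
    (fun p : G.pts R × (twist G A χ).obj R => (p.1 • p.2, p.2)) := by
  constructor
  · rintro ⟨h, x⟩ ⟨h', x'⟩ heq
    obtain ⟨h₁, rfl⟩ := Prod.mk.inj heq
    have h₂ := congrArg Subtype.val h₁
    rw [twist_smul_coe, twist_smul_coe] at h₂
    exact Prod.ext (map_inr_injective A R (mul_right_cancel h₂)) rfl
  · rintro ⟨y, x⟩
    obtain ⟨h, hh, -⟩ := existsUnique_map_inr A (y.1 * x.1⁻¹) fun S a b r => by
      rw [map_mul, map_mul, map_inv, map_inv, x.2 S a b r, y.2 S a b r]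
      group
    refine ⟨(h, x), Prod.ext (Subtype.ext ?_) rfl⟩
    change G.map (inr A R) h * x.1 = y.1
    rw [hh, inv_mul_cancel_right]

theorem twist_hasDescent : HasDescent A (twist G A χ) := by
  intro R p hp
  -- In `A ⊗ (A ⊗ R)` the first `A` belongs to the twist and the second to the descent datum.
  -- Swapping them lets descent for `G` remove the second.
  let sw : tensor A (tensor A R) ⟶ tensor A (tensor A R) :=
    desc (inl A R ≫ inr A (tensor A R))
      (desc (inl A (tensor A R)) (inr A R ≫ inr A (tensor A R)))
  have hsw : sw ≫ sw = 𝟙 _ := by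
    apply tensor_hom_ext
    · rw [← Category.assoc, inl_desc, Category.assoc, inr_desc, inl_desc, Category.comp_id]
    · rw [← Category.assoc, inr_desc, desc_comp, inl_desc, Category.assoc, inr_desc, inr_desc,
        desc_inl_comp_inr_comp, Category.comp_id]
  obtain ⟨q, hq, -⟩ := existsUnique_map_inr A (G.map sw p.1) fun S a b r => by
    have key : ∀ a : A ⟶ S, G.map (desc a r) (G.map sw p.1) =
        G.map (desc (inl A R ≫ r) (𝟙 S))
          ((twist G A χ).map (desc a (inr A R ≫ r)) p).1 := by
      intro a
      rw [twist_map_coe, ← map_comp_apply, ← map_comp_apply, desc_comp, desc_comp, desc_comp,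
        inl_desc, inl_desc, Category.assoc, Category.assoc, Category.assoc, inr_desc, inr_desc,
        Category.comp_id]
    rw [key, key, hp]
  have hqp : G.map (desc (inl A (tensor A R)) (inr A R ≫ inr A (tensor A R))) q = p.1 := by
    have h := congrArg (G.map sw) hq
    rw [← map_comp_apply, ← map_comp_apply, hsw, inr_desc] at h
    rw [h]
    simp [map]
  refine ⟨⟨q, fun S a b r => ?_⟩, Subtype.ext hqp, fun q' hq' => Subtype.ext ?_⟩
  · have h := p.2 S a b (desc a r)
    rw [← hqp, ← map_comp_apply, ← map_comp_apply, desc_comp, desc_comp, inl_desc, inl_desc,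
      Category.assoc, Category.assoc, inr_desc, inr_desc, inr_desc, inr_desc] at h
    exact h
  · have h := congrArg Subtype.val hq'
    beta_reduce at h
    rw [twist_map_coe, ← hqp] at h
    replace h := congrArg (G.map (desc (inl A R) (𝟙 _))) h
    rw [← map_comp_apply, ← map_comp_apply, desc_comp, inl_desc, Category.assoc, inr_desc,
      Category.comp_id, desc_inl_inr] at h
    simpa [map] using h

/-- Over `A`-algebras `twistPoint` trivializes the twist, so `A ⊗ C` corepresents it there, with
universal point `u`. -/
theorem twist_isDiffVariety (hχ : G.IsCocycle A χ) : IsDiffVariety (twist G A χ) := by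
  obtain ⟨C, hC, ⟨e⟩⟩ := G.isDiffVariety
  let E : ∀ {R : DiffAlg σ}, (C ⟶ R) ≃ G.pts R := e.homEquiv
  let c : G.pts C := E (𝟙 C)
  have hc : ∀ {R : DiffAlg σ} (f : C ⟶ R), G.map f c = E f := fun f => (e.homEquiv_eq f).symm
  let u : (twist G A χ).obj (tensor A C) :=
    G.map (inr A C) c • (twist G A χ).map (inl A C) (twistPoint hχ)
  have hu : ∀ {R : DiffAlg σ} (φ : tensor A C ⟶ R), (twist G A χ).map φ u =
      E (inr A C ≫ φ) •
        (twist G A χ).map (inl A C ≫ φ) (twistPoint hχ) := fun φ => by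
    rw [twist_map_smul, ← map_comp_apply, hc, ← Functor.map_comp_apply]
  obtain ⟨B, j, θ, hθ, hθ', hB⟩ := exists_corepresentableBy_of_descent twist_hasDescent (inl A C) u
    fun R ι p => by
      obtain ⟨⟨h, x⟩, hx⟩ := (twist_bijective R).2 (p, (twist G A χ).map ι (twistPoint hχ))
      obtain ⟨hx, rfl⟩ := Prod.mk.inj hx
      refine ⟨desc ι (E.symm h), ⟨inl_desc _ _, ?_⟩, ?_⟩
      · rw [hu, inl_desc, inr_desc, Equiv.apply_symm_apply]
        exact hx
      · rintro φ ⟨rfl, hφ⟩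
        rw [hu] at hφ
        have h' : (E (inr A C ≫ φ), (twist G A χ).map (inl A C ≫ φ) (twistPoint hχ)) =
          (h, (twist G A χ).map (inl A C ≫ φ) (twistPoint hχ)) :=
          (twist_bijective R).1 (Prod.ext (hφ.trans hx.symm) rfl)
        rw [← (Prod.mk.inj h').1, Equiv.symm_apply_apply, desc_inl_comp_inr_comp]
  refine ⟨B, finSigmaGenerated_of_tensor hC θ ?_ fun z => ⟨(desc (inl A C) j).toAlgHom z, ?_⟩, hB⟩
  · rw [← inl_desc (inl A C) j, Category.assoc, hθ', Category.comp_id]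
  · exact congrArg (fun f => DiffAlg.Hom.toAlgHom f z) hθ'

variable (χ) in
/-- The `G`-torsor obtained by twisting the trivial torsor by a cocycle. -/
noncomputable def twistTorsor (hχ : G.IsCocycle A χ) : DiffTorsor G where
  functor := twist G A χ
  isDiffVariety := twist_isDiffVariety hχ
  nonempty := ⟨A, inferInstance, ⟨twistPoint hχ⟩⟩
  map_smul := twist_map_smul
  bijective := twist_bijective

end Field

end DiffAlgGroup

/-! ### Points of torsors and their cocycles. -/

namespace DiffTorsor

open DiffAlg

section CommRing

variable {k : Type u} [CommRing k] {σ : k →+* k} {G : DiffAlgGroup σ}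

theorem smul_right_injective (X : DiffTorsor G) {R : DiffAlg σ} {g h : G.pts R}
    {x : X.functor.obj R} (H : g • x = h • x) : g = h :=
  (Prod.mk.inj ((X.bijective R).1 (a₁ := (g, x)) (a₂ := (h, x)) (Prod.ext H rfl))).1

theorem exists_smul_eq (X : DiffTorsor G) {R : DiffAlg σ} (x y : X.functor.obj R) :
    ∃ g : G.pts R, y = g • x := by
  obtain ⟨⟨g, x'⟩, h⟩ := (X.bijective R).2 (y, x)
  obtain ⟨rfl, rfl⟩ := Prod.mk.inj h
  exact ⟨g, rfl⟩

/-- The element `χ` measures the failure of `x ∈ X(A)` to descend: `δ₁(x) = χ • δ₂(x)`. -/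
def HasCocycle (X : DiffTorsor G) {A : DiffAlg σ} (x : X.functor.obj A) (χ : G.pts A.tensor₂) :
    Prop :=
  X.functor.map A.δ₁ x = χ • X.functor.map A.δ₂ x

variable {X Y : DiffTorsor G} {A B : DiffAlg σ} {x : X.functor.obj A} {χ : G.pts A.tensor₂}

theorem exists_hasCocycle (x : X.functor.obj A) : ∃ χ : G.pts A.tensor₂, X.HasCocycle x χ :=
  X.exists_smul_eq _ _

theorem HasCocycle.map_eq (h : X.HasCocycle x χ) {S : DiffAlg σ} (a b : A ⟶ S) :
    X.functor.map b x = G.map (desc a b) χ • X.functor.map a x := by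
  have h' := congrArg (X.functor.map (desc a b)) h
  rw [X.map_smul, ← Functor.map_comp_apply, ← Functor.map_comp_apply, δ₁, δ₂, inl_desc,
    inr_desc] at h'
  exact h'

/-- Passing from `a(x)` to `c(x)` directly or through `b(x)` gives the same element, as the action
is free. -/
theorem HasCocycle.isCocycle (h : X.HasCocycle x χ) : G.IsCocycle A χ :=
  DiffAlgGroup.isCocycle_iff.2 fun S a b c => X.smul_right_injective (x := X.functor.map a x) (by
    rw [mul_smul, ← h.map_eq a b, ← h.map_eq b c, ← h.map_eq a c])

theorem HasCocycle.map (h : X.HasCocycle x χ) (f : A ⟶ B) :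
    X.HasCocycle (X.functor.map f x) (G.map (map₂ f) χ) := by
  rw [HasCocycle, ← Functor.map_comp_apply, ← Functor.map_comp_apply, h.map_eq (f ≫ B.δ₂)]
  rfl

theorem HasCocycle.smul (h : X.HasCocycle x χ) (α : G.pts A) :
    X.HasCocycle (α • x) (G.map A.δ₁ α * χ * (G.map A.δ₂ α)⁻¹) := by
  have h' : X.functor.map A.δ₁ x = χ • X.functor.map A.δ₂ x := h
  rw [HasCocycle, X.map_smul, X.map_smul, h', mul_smul, mul_smul, inv_smul_smul]

theorem HasCocycle.hom (h : X.HasCocycle x χ) (f : X ⟶ Y) :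
    Y.HasCocycle (f.toNatTrans.app A x) χ := by
  have h' := congrArg (f.toNatTrans.app A.tensor₂) h
  rw [f.app_smul, NatTrans.naturality_apply, NatTrans.naturality_apply] at h'
  exact h'

theorem HasCocycle.mk_eq {x' : X.functor.obj A} {χ' : G.pts A.tensor₂} (h : X.HasCocycle x χ)
    (h' : X.HasCocycle x' χ') :
    DiffAlgGroup.H1.mk G A χ h.isCocycle = DiffAlgGroup.H1.mk G A χ' h'.isCocycle := by
  obtain ⟨α, rfl⟩ := X.exists_smul_eq x' x
  exact Quotient.sound ⟨α, X.smul_right_injective (h.symm.trans (h'.smul α))⟩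

end CommRing

section Field

variable {k : Type u} [Field k] {σ : k →+* k} {G : DiffAlgGroup σ} {X Y : DiffTorsor G}
  {A : DiffAlg σ} [Nontrivial A]

theorem hasDescent (X : DiffTorsor G) (A : DiffAlg σ) [Nontrivial A] :
    HasDescent A X.functor := by
  obtain ⟨C, -, ⟨e⟩⟩ := X.isDiffVariety
  exact hasDescent_of_corepresentableBy A e

/-- Over `A ⊗ R` every point is a translate of `x`, and `Y(R)` injects into `Y(A ⊗ R)`. -/
theorem hom_ext_of_point (x : X.functor.obj A) {f g : X ⟶ Y}
    (h : f.toNatTrans.app A x = g.toNatTrans.app A x) : f = g := by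
  apply DiffTorsor.Hom.ext
  refine NatTrans.ext (funext fun R => ConcreteCategory.hom_ext _ _ fun p => ?_)
  apply (Y.hasDescent A).injective R
  obtain ⟨c, hc⟩ := X.exists_smul_eq (X.functor.map (inl A R) x) (X.functor.map (inr A R) p)
  rw [← NatTrans.naturality_apply, ← NatTrans.naturality_apply, hc, f.app_smul, g.app_smul,
    NatTrans.naturality_apply, NatTrans.naturality_apply, h]

/-- Over `A ⊗ R` write `p = g • x` and send it to `g • y`. Since `x` and `y` vary by the same `χ`,
the point `g • y` descends to `R` because `p` does. -/
theorem exists_hom_of_hasCocycle {χ : G.pts A.tensor₂} {x : X.functor.obj A}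
    {y : Y.functor.obj A} (hx : X.HasCocycle x χ) (hy : Y.HasCocycle y χ) :
    ∃ f : X ⟶ Y, f.toNatTrans.app A x = y := by
  have key : ∀ (R : DiffAlg σ) (p : X.functor.obj R), ∃ q : Y.functor.obj R,
      ∃ g : G.pts (tensor A R), X.functor.map (inr A R) p = g • X.functor.map (inl A R) x ∧
        Y.functor.map (inr A R) q = g • Y.functor.map (inl A R) y := by
    intro R p
    obtain ⟨g, hg⟩ := X.exists_smul_eq (X.functor.map (inl A R) x) (X.functor.map (inr A R) p)
    have hr : ∀ {S : DiffAlg σ} (a : A ⟶ S) (r : R ⟶ S),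
        X.functor.map r p = G.map (desc a r) g • X.functor.map a x := fun a r => by
      have h := congrArg (X.functor.map (desc a r)) hg
      rwa [X.map_smul, ← Functor.map_comp_apply, ← Functor.map_comp_apply, inl_desc,
        inr_desc] at h
    obtain ⟨q, hq, -⟩ := Y.hasDescent A R (g • Y.functor.map (inl A R) y) fun S a b r => by
      have h : G.map (desc a r) g = G.map (desc b r) g * G.map (desc a b) χ :=
        X.smul_right_injective (x := X.functor.map a x) (by
          rw [← hr, mul_smul, ← hx.map_eq, ← hr])
      rw [Y.map_smul, Y.map_smul, ← Functor.map_comp_apply, ← Functor.map_comp_apply, inl_desc,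
        inl_desc, h, mul_smul, ← hy.map_eq]
    exact ⟨q, g, hg, hq⟩
  have unique : ∀ {R : DiffAlg σ} {p : X.functor.obj R} {q q' : Y.functor.obj R}
      {g g' : G.pts (tensor A R)}, X.functor.map (inr A R) p = g • X.functor.map (inl A R) x →
      Y.functor.map (inr A R) q = g • Y.functor.map (inl A R) y →
      X.functor.map (inr A R) p = g' • X.functor.map (inl A R) x →
      Y.functor.map (inr A R) q' = g' • Y.functor.map (inl A R) y → q = q' := by
    intro R p q q' g g' h₁ h₂ h₃ h₄
    have := X.smul_right_injective (h₁.symm.trans h₃)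
    subst this
    exact (Y.hasDescent A).injective R (h₂.trans h₄.symm)
  choose f c hc hf using key
  refine ⟨⟨⟨fun R => TypeCat.ofHom (f R), fun R S φ => ?_⟩, fun R g p => ?_⟩, ?_⟩
  · have hmap : ∀ {Z : DiffTorsor G} {z : Z.functor.obj A} {w : Z.functor.obj R}
        {g : G.pts (tensor A R)},
        Z.functor.map (inr A R) w = g • Z.functor.map (inl A R) z →
        Z.functor.map (inr A S) (Z.functor.map φ w) =
          G.map (desc (inl A S) (φ ≫ inr A S)) g • Z.functor.map (inl A S) z := by
      intro Z z w g h
      have h' := congrArg (Z.functor.map (desc (inl A S) (φ ≫ inr A S))) h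
      rwa [Z.map_smul, ← Functor.map_comp_apply, ← Functor.map_comp_apply, inl_desc, inr_desc,
        Functor.map_comp_apply] at h'
    refine ConcreteCategory.hom_ext _ _ fun p => ?_
    exact unique (hc S (X.functor.map φ p)) (hf S _) (hmap (hc R p)) (hmap (hf R p))
  · refine unique (hc R (g • p)) (hf R _) (g' := G.map (inr A R) g * c R p) ?_ ?_
    · rw [X.map_smul, hc R p, mul_smul]
    · rw [Y.map_smul, mul_smul]
      exact congrArg _ (hf R p)
  · exact unique (hc A x) (hf A x) hx hy

theorem isoClass_eq_of_hasCocycle {χ : G.pts A.tensor₂} {x : X.functor.obj A}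
    {y : Y.functor.obj A} (hx : X.HasCocycle x χ) (hy : Y.HasCocycle y χ) :
    X.isoClass = Y.isoClass := by
  obtain ⟨f, hf⟩ := exists_hom_of_hasCocycle hx hy
  obtain ⟨g, hg⟩ := exists_hom_of_hasCocycle hy hx
  refine Quotient.sound ⟨⟨f, g, hom_ext_of_point x ?_, hom_ext_of_point y ?_⟩⟩
  · change g.toNatTrans.app A (f.toNatTrans.app A x) = x
    rw [hf, hg]
  · change f.toNatTrans.app A (g.toNatTrans.app A y) = y
    rw [hg, hf]

theorem exists_hasCocycle_of_isCocycle {χ : G.pts A.tensor₂} (hχ : G.IsCocycle A χ) :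
    ∃ (X : DiffTorsor G) (x : X.functor.obj A), X.HasCocycle x χ :=
  ⟨G.twistTorsor χ hχ, DiffAlgGroup.twistPoint hχ, DiffAlgGroup.twist_map_δ₁_twistPoint hχ⟩

end Field

end DiffTorsor

/-! ### Cohomology classes as isomorphism classes of torsors. -/

namespace DiffAlgGroup

open DiffAlg DiffTorsor

variable {k : Type u} [Field k] {σ : k →+* k} {G : DiffAlgGroup σ}

/-- Classes in `H¹(A/k, G)` arise from points of torsors. -/
theorem exists_torsor {A : DiffAlg σ} [Nontrivial A] (c : G.H1 A) :
    ∃ (X : DiffTorsor G) (x : X.functor.obj A) (χ : G.pts A.tensor₂) (h : X.HasCocycle x χ),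
      H1.mk G A χ h.isCocycle = c := by
  obtain ⟨⟨χ, hχ⟩, rfl⟩ := Quotient.exists_rep c
  obtain ⟨X, x, h⟩ := exists_hasCocycle_of_isCocycle hχ
  exact ⟨X, x, χ, h, rfl⟩

/-- The isomorphism class of the torsors attached to a class in `H¹(A/k, G)`. -/
noncomputable def torsorClass {A : DiffAlg σ} [Nontrivial A] (c : G.H1 A) : IsoClasses G :=
  (exists_torsor c).choose.isoClass

/-- The choice in `torsorClass` is harmless: an equivalent cocycle is the cocycle of a translate `α
• x` in the same torsor. -/
theorem torsorClass_mk {A : DiffAlg σ} [Nontrivial A] {X : DiffTorsor G} {x : X.functor.obj A}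
    {χ : G.pts A.tensor₂} (h : X.HasCocycle x χ) :
    torsorClass (H1.mk G A χ h.isCocycle) = X.isoClass := by
  obtain ⟨y, χ', h', heq⟩ := (exists_torsor (H1.mk G A χ h.isCocycle)).choose_spec
  obtain ⟨α, hα⟩ := Quotient.exact heq
  have h'' := h.smul α
  have hα' : χ' = G.map A.δ₁ α * χ * (G.map A.δ₂ α)⁻¹ := hα
  rw [← hα'] at h''
  exact isoClass_eq_of_hasCocycle h' h''

theorem mapH1_mk {A B : DiffAlg σ} (f : A ⟶ B) {X : DiffTorsor G} {x : X.functor.obj A}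
    {χ : G.pts A.tensor₂} (h : X.HasCocycle x χ) :
    G.mapH1 f (H1.mk G A χ h.isCocycle) = H1.mk G B _ (h.map f).isCocycle := rfl

theorem torsorClass_mapH1 {A B : DiffAlg σ} [Nontrivial A] [Nontrivial B] (f : A ⟶ B)
    (c : G.H1 A) : torsorClass (G.mapH1 f c) = torsorClass c := by
  obtain ⟨X, x, χ, h, rfl⟩ := exists_torsor c
  rw [mapH1_mk f h, torsorClass_mk h]
  exact torsorClass_mk (h.map f)

/-- An isomorphism carries `x` to a point of `Y` with the same cocycle, and two `A`-points of `Y`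
have equivalent cocycles. -/
theorem torsorClass_injective {A : DiffAlg σ} [Nontrivial A] :
    Function.Injective (torsorClass : G.H1 A → IsoClasses G) := by
  intro c c' hc
  obtain ⟨X, x, χ, h, rfl⟩ := exists_torsor c
  obtain ⟨Y, y, χ', h', rfl⟩ := exists_torsor c'
  rw [torsorClass_mk h, torsorClass_mk h'] at hc
  obtain ⟨i⟩ := Quotient.exact hc
  exact (h.hom i.hom).mk_eq h'

variable (G) in
/-- The map from `H¹(k, G)` to isomorphism classes of torsors. -/
noncomputable def limTorsorClass : G.H1lim → IsoClasses G :=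
  Quot.lift (fun c => haveI := c.1.2; torsorClass c.2) (by
    rintro ⟨⟨A, hA⟩, c⟩ ⟨⟨B, hB⟩, c'⟩ ⟨f, hf⟩
    exact (torsorClass_mapH1 f c).symm.trans (congrArg torsorClass hf))

theorem toH1lim_mapH1 {A B : DiffAlg σ} (hA : Nontrivial A) (hB : Nontrivial B) (f : A ⟶ B)
    (c : G.H1 A) : G.toH1lim B hB (G.mapH1 f c) = G.toH1lim A hA c :=
  (Quot.sound ⟨f, rfl⟩ : G.toH1lim A hA c = G.toH1lim B hB (G.mapH1 f c)).symm

theorem limTorsorClass_bijective : Function.Bijective (limTorsorClass G) := by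
  constructor
  · rintro ⟨⟨⟨A, hA⟩, c⟩⟩ ⟨⟨⟨B, hB⟩, c'⟩⟩ h
    obtain ⟨s, hs⟩ := exists_linearForm A
    -- `B` embeds in `A ⊗ B`, so this common target of `A` and `B` is a legitimate index of the
    -- limit.
    have hAB : Nontrivial (tensor A B) := (inr_injective hs B).nontrivial
    have h' : torsorClass c = torsorClass c' := h
    rw [← torsorClass_mapH1 (inl A B) c, ← torsorClass_mapH1 (inr A B) c'] at h'
    change G.toH1lim A hA c = G.toH1lim B hB c'
    rw [← toH1lim_mapH1 hA hAB (inl A B) c, ← toH1lim_mapH1 hB hAB (inr A B) c',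
      torsorClass_injective h']
  · intro t
    obtain ⟨X, rfl⟩ := Quotient.exists_rep t
    obtain ⟨A, hA, ⟨x⟩⟩ := X.nonempty
    obtain ⟨χ, h⟩ := exists_hasCocycle x
    exact ⟨G.toH1lim A hA (H1.mk G A χ h.isCocycle), torsorClass_mk h⟩

end DiffAlgGroup

theorem theorem5p2 {k : Type u} [Field k] (σ : k →+* k) (G : DiffAlgGroup σ) :
    (∀ (A B : DiffAlg σ), Nontrivial A → Nontrivial B → ∀ f g : A ⟶ B,
      G.mapH1 f = G.mapH1 g ∧ Function.Injective (G.mapH1 f)) ∧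
    ∃ Φ : G.H1lim ≃ DiffTorsor.IsoClasses G,
      ∀ (X : DiffTorsor G) (A : DiffAlg σ) (hA : Nontrivial A) (x : X.functor.obj A)
        (χ : G.pts A.tensor₂),
        X.functor.map A.δ₁ x = χ • X.functor.map A.δ₂ x →
          ∃ hχ : G.IsCocycle A χ,
            Φ (G.toH1lim A hA (DiffAlgGroup.H1.mk G A χ hχ)) = X.isoClass := by
  refine ⟨fun A B hA hB f g => ⟨?_, ?_⟩, ?_⟩
  · funext c
    apply DiffAlgGroup.torsorClass_injective
    rw [DiffAlgGroup.torsorClass_mapH1, DiffAlgGroup.torsorClass_mapH1]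
  · intro c c' h
    apply DiffAlgGroup.torsorClass_injective
    rw [← DiffAlgGroup.torsorClass_mapH1 f c, h, DiffAlgGroup.torsorClass_mapH1]
  · exact ⟨Equiv.ofBijective _ DiffAlgGroup.limTorsorClass_bijective, fun X A hA x χ h =>
      ⟨DiffTorsor.HasCocycle.isCocycle h, DiffAlgGroup.torsorClass_mk h⟩⟩
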